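/- **Setting.** Let $\mathcal A\subset\mathbb N$ be a finite set of addresses, $\mathcal G$ a partition of $\mathcal A$ into non-empty gates, $\mathcal D$ a finite set, $n\in\mathbb N$ and $\mathcal Q=\mathcal D^{\le n}$ the set of words over $\mathcal D$ of length at most $n$. Let $\mathcal W$ be the set of words over $\mathcal A$ without repeated letters and $\mathcal T=\mathcal A\cup\{\varepsilon\}$. A basis state of a sector is $(t;\bar a,\bar q;\bar a',\bar q')$ with target $t\in\mathcal T$, input $(\bar a,\bar q)\in\mathcal W\times\mathcal Q$ and output $(\bar a',\bar q')\in\mathcal W\times\mathcal Q$; $\mathcal H_{\mathcal S}$ is the Hilbert space with these states as orthonormal basis. A gate operator on $g\in\mathcal G$ is a unitary $S^g$ of $\bigotimes_{a\in g}\mathcal H_{\mathcal S}^a$ such that $\langle x'|S^g|x\rangle\ne0$ for basis states $x,x'$ implies that the target and stored addresses occurring in $x'$ and in $x$ are the same, counted with multiplicity. A skeleton is a tuple $K=(\mathcal A,\mathcal G,\mathcal Q,S)$, where $S$ assigns a gate operator $S^g$ to each $g\in\mathcal G$. The circuit space $\mathcal H$ is spanned by the basis states $c$ of $\bigotimes_{a\in\mathcal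 A}\mathcal H_{\mathcal S}^a$ in which every address appears at most once in total among the targets and stored words. An addressable quantum circuit (AQC) is $C=(K,\psi)$ with $\psi\in\mathcal H$. It evolves in one step into $GC=(K,G\psi)$, where $G=TS$, $S=\bigotimes_{g}S^g$, and $T$ is the linear extension of the permutation of basis states that, synchronously for all pairs of sectors $i,j$ such that $i$ has target $j$, swaps the output of $i$ with the input of $j$, leaving the rest unchanged. **Encoding.** For a basis state $c$ of $\mathcal H$, $\mathbf G_c$ is the following labelled graph with ports (edges are pairs of half-edges $v:p$, with every half-edge in at most one edge). The vertices are $s_a$ ($a\in\mathcal A$) and $r_g$ ($g\in\mathcal G$). The ports are $p_a$ ($a\in\mathcal A$), $e$, $\tau$, $in_i$ and $out_i$ ($1\le i\le|\mathcal A|$). If sector $a$ is in state $(t;\bar a,\bar q;\bar a',\bar q')$, then $s_a$ has label $(\bar q,\bar q')$ and there are the edges $\{s_a:in_i,\,s_{a_i}:e\}$ and $\{s_a:out_i,\,s_{a'_i}:e\}$ for the letters $a_i$ of $\bar a$ and $a'_i$ of $\bar a'$, and $\{s_a:\tau,\,s_t:e\}$ if $t\neq\varepsilon$. Moreover $r_g$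 has label $S^g$, and there is an edge $\{s_a:p_a,\,r_g:p_a\}$ whenever $a\in g$. For $C=(K,\sum_c\alpha_c|c\rangle)$ put $e(C)=\sum_c\alpha_c|\mathbf G_c\rangle$, an element of the space of finite superpositions of such labelled port graphs. **Dynamics.** Let $E=E_TE_S$ be the linear operator on superpositions of labelled port graphs (the labels of the $r_g$ being arbitrary gate operators on $g$) given on basis graphs as follows. - $E_S$ acts on graphs of the form $\mathbf G_c$, with any gate operators as labels of the $r_g$, synchronously at all $r_g$: it reads the basis state of each sector $a\in g$ off the graph (the target is $t$ if there is an edge $\{s_a:\tau,s_t:e\}$ and $\varepsilon$ otherwise; the $i$-th letter of the input word is $z$ if there is an edge $\{s_a:in_i,s_z:e\}$ and empty otherwise; likewise with $out_i$ for the output word; the data words are the label of $s_a$), applies the operator that labels $r_g$ to the state of the sectors of $g$, and rewrites the edges at the ports $\tau,in_i,out_i$ and the labels of the sector vertices from the resulting superposition by the rules defining $\mathbf G_c$. Other graphs are left unchanged. - $E_T$ acts synchronously for all edges $\{s_a:\tau,\,s_t:e\}$: for every $j$, the edge at $s_t:in_j$ is moved to $s_a:out_j$ and the edge at $s_a:out_j$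 is moved to $s_t:in_j$, and the second part of the label of $s_a$ is swapped with the first part of the label of $s_t$. **Proposition (Equivalence of Evolution of Encoding).** For every AQC $C$, $$e(GC)=E\,e(C),\qquad E=E_TE_S,\quad G=TS .$$ -/

import Mathlib

open scoped BigOperators

namespace AQC

universe u

/-! ## Addresses, data, sectors and gates -/

/-- The part `(𝒜, 𝒢, 𝒬)` of a skeleton: a finite set of addresses `𝒜 ⊆ ℕ`, a partition `𝒢` of `𝒜` into
non-empty gates, and the data words `𝒬 = 𝒟^{≤ n}` over a finite set `𝒟` of data values. -/
structure Layout : Type (u + 1) where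
  addresses : Finset ℕ
  gates : Finpartition (Finset.univ : Finset addresses)
  DataValue : Type u
  [finiteData : Finite DataValue]
  maxLength : ℕ

attribute [instance] Layout.finiteData

/-- An address of the layout. -/
abbrev Layout.Address (L : Layout.{u}) : Type := {a : ℕ // a ∈ L.addresses}

/-- A gate of the layout. -/
abbrev Layout.Gate (L : Layout.{u}) : Type := {g : Finset L.Address // g ∈ L.gates.parts}

/-- `𝒲 = 𝒜⁻`: words of addresses in which no address repeats. -/
abbrev Layout.StoredWord (L : Layout.{u}) : Type := {w : List L.Address // w.Nodup}

/-- `𝒬 = 𝒟^{≤ n}`: data words of length at most `n`. -/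
abbrev Layout.DataWord (L : Layout.{u}) : Type u :=
  {q : List L.DataValue // q.length ≤ L.maxLength}

/-- A basis state `|t⟩_𝒯 |ā, q̄⟩_ℐ |ā', q̄'⟩_𝒪` of a sector space; `target = none` is `t = ε`. -/
@[ext]
structure Layout.SectorState (L : Layout.{u}) : Type u where
  target : Option L.Address
  inp : L.StoredWord × L.DataWord
  out : L.StoredWord × L.DataWord

instance Layout.finite_dataWord (L : Layout.{u}) : Finite L.DataWord :=
  (List.finite_length_le L.DataValue L.maxLength).to_subtype

instance Layout.finite_sectorState (L : Layout.{u}) : Finite L.SectorState :=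
  Finite.of_injective
    (fun s : L.SectorState => (s.target, s.inp, s.out))
    (fun s t h => by
      simp only [Prod.mk.injEq] at h
      exact Layout.SectorState.ext h.1 h.2.1 h.2.2)

noncomputable instance Layout.fintype_sectorState (L : Layout.{u}) : Fintype L.SectorState :=
  Fintype.ofFinite _

noncomputable instance Layout.decidableEq_sectorState (L : Layout.{u}) :
    DecidableEq L.SectorState :=
  Classical.decEq _

/-- All target and stored addresses occurring in a sector, with multiplicity. -/
def Layout.SectorState.letters {L : Layout.{u}} (s : L.SectorState) : Multiset L.Address :=
  ((s.target.toList ++ s.inp.1.1 ++ s.out.1.1 : List L.Address) : Multiset L.Address)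

/-- A basis state of the gate space `ℋ^g = ⨂_{a ∈ g} ℋ_𝒮^a`. -/
abbrev Layout.GateState (L : Layout.{u}) (g : Finset L.Address) : Type u :=
  {a : L.Address // a ∈ g} → L.SectorState

/-- A gate operator on `g`: a unitary of `ℋ^g`, given by its matrix `matrix x' x = ⟨x'| S^g |x⟩` in the
canonical basis, which preserves the addresses of the target and stored spaces. -/
@[ext]
structure GateOperator (L : Layout.{u}) (g : Finset L.Address) : Type u where
  matrix : Matrix (L.GateState g) (L.GateState g) ℂ
  unitary : matrix ∈ Matrix.unitaryGroup (L.GateState g) ℂ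
  preserves_letters : ∀ x' x : L.GateState g, matrix x' x ≠ 0 →
    ∑ a, (x' a).letters = ∑ a, (x a).letters

/-- A skeleton `(𝒜, 𝒢, 𝒬, S)`. -/
structure Skeleton : Type (u + 1) extends Layout.{u} where
  op : ∀ g : toLayout.Gate, GateOperator toLayout g.1

/-! ## The circuit space and its evolution -/

/-- A basis state of `⨂_{a ∈ 𝒜} ℋ_𝒮^a`. -/
abbrev Layout.Config (L : Layout.{u}) : Type u := L.Address → L.SectorState

/-- Each address appears at most once in the whole circuit (as a target or as a stored address). -/
def Layout.Config.LettersOnce {L : Layout.{u}} (c : L.Config) : Prop :=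
  (∑ a, (c a).letters).Nodup

/-- The canonical basis of the circuit space. -/
abbrev Layout.CircuitState (L : Layout.{u}) : Type u := {c : L.Config // c.LettersOnce}

noncomputable instance Layout.fintype_circuitState (L : Layout.{u}) : Fintype L.CircuitState :=
  Fintype.ofFinite _

noncomputable instance Layout.decidableEq_circuitState (L : Layout.{u}) :
    DecidableEq L.CircuitState :=
  Classical.decEq _

/-- The circuit Hilbert space: superpositions of the basis states of `⨂_{a ∈ 𝒜} ℋ_𝒮^a` in which every
address appears at most once. -/
abbrev Layout.CircuitSpace (L : Layout.{u}) : Type u := EuclideanSpace ℂ L.CircuitState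

/-- The part of a configuration that lies in the gate `g`. -/
def Layout.Config.restrict {L : Layout.{u}} (c : L.Config) (g : Finset L.Address) : L.GateState g :=
  fun a => c a.1

/-- The matrix element `⟨c'| ⨂_g S^g |c⟩ = ∏_g ⟨c'|_g| S^g |c|_g⟩`. -/
noncomputable def Layout.scatteringAmplitude {L : Layout.{u}}
    (op : ∀ g : L.Gate, GateOperator L g.1) (c' c : L.Config) : ℂ :=
  ∏ g : L.Gate, (op g).matrix (c'.restrict g.1) (c.restrict g.1)

/-- The scattering step `S = ⨂_g S^g` on the circuit space. -/
noncomputable def Skeleton.scattering (K : Skeleton.{u}) :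
    K.CircuitSpace →ₗ[ℂ] K.CircuitSpace :=
  Matrix.toEuclideanLin
    (Matrix.of fun c' c : K.CircuitState => Layout.scatteringAmplitude K.op c'.1 c.1)

open Classical in
/-- The sector that targets sector `j`, if there is one. -/
noncomputable def Layout.Config.source {L : Layout.{u}} (c : L.Config) (j : L.Address) :
    Option L.Address :=
  if h : ∃ i, (c i).target = some j then some h.choose else none

/-- If sector `i` targets sector `j`, the output of `i` is swapped with the input of `j`, synchronously for
all such pairs; the rest is unchanged. -/
noncomputable def Layout.Config.transport {L : Layout.{u}} (c : L.Config) : L.Config := fun a =>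
  { target := (c a).target
    inp := match c.source a with
      | some i => (c i).out
      | none => (c a).inp
    out := match (c a).target with
      | some j => (c j).inp
      | none => (c a).out }

section TransportWellDefined

variable {L : Layout.{u}}

theorem Layout.Config.LettersOnce.sector_unique {c : L.Config} (hc : c.LettersOnce)
    {z a a' : L.Address} (h : z ∈ (c a).letters) (h' : z ∈ (c a').letters) : a = a' := by
  by_contra hne
  have h1 := Multiset.nodup_iff_count_le_one.1 hc z
  rw [Multiset.count_sum'] at h1
  have h2 : ∑ x ∈ ({a, a'} : Finset L.Address), (c x).letters.count z ≤
      ∑ x, (c x).letters.count z :=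
    Finset.sum_le_sum_of_subset (Finset.subset_univ _)
  rw [Finset.sum_pair hne] at h2
  have h3 := Multiset.one_le_count_iff_mem.2 h
  have h4 := Multiset.one_le_count_iff_mem.2 h'
  omega

theorem Layout.SectorState.mem_letters_of_target {s : L.SectorState} {z : L.Address}
    (h : s.target = some z) : z ∈ s.letters := by
  simp [Layout.SectorState.letters, h]

theorem Layout.Config.LettersOnce.source_eq_some {c : L.Config} (hc : c.LettersOnce)
    {i j : L.Address} : c.source j = some i ↔ (c i).target = some j := by
  unfold Layout.Config.source
  constructor
  · intro h
    split_ifs at h with hex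
    · rw [← Option.some.inj h]; exact hex.choose_spec
  · intro h
    have hex : ∃ i, (c i).target = some j := ⟨i, h⟩
    rw [dif_pos hex]
    exact congrArg some (hc.sector_unique
      (Layout.SectorState.mem_letters_of_target hex.choose_spec)
      (Layout.SectorState.mem_letters_of_target h))

theorem Layout.Config.LettersOnce.transport {c : L.Config} (hc : c.LettersOnce) :
    c.transport.LettersOnce := by
  -- `box` lists the words of all input (`inl`) and output (`inr`) registers; `swap` permutes them
  let box (c : L.Config) : L.Address ⊕ L.Address → Multiset L.Address :=
    Sum.elim (fun a => ((c a).inp.1.1 : Multiset _)) (fun a => ((c a).out.1.1 : Multiset _))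
  let swap : L.Address ⊕ L.Address → L.Address ⊕ L.Address :=
    Sum.elim (fun a => match c.source a with
        | some i => Sum.inr i
        | none => Sum.inl a)
      (fun a => match (c a).target with
        | some j => Sum.inl j
        | none => Sum.inr a)
  have hswap : Function.Involutive swap := by
    rintro (a | a)
    · rcases h : c.source a with _ | i
      · simp [swap, h]
      · simp [swap, h, hc.source_eq_some.1 h]
    · rcases h : (c a).target with _ | j
      · simp [swap, h]
      · simp [swap, h, hc.source_eq_some.2 h]
  have hbox : ∀ x, box c.transport x = box c (swap x) := by
    rintro (a | a)
    · rcases h : c.source a with _ | i <;> simp [box, swap, Layout.Config.transport, h]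
    · rcases h : (c a).target with _ | j <;> simp [box, swap, Layout.Config.transport, h]
  have hsum : ∀ d : L.Config, ∑ a, (d a).letters =
      ∑ a, ((d a).target.toList : Multiset L.Address) + ∑ x, box d x := by
    intro d
    rw [Fintype.sum_sum_type, ← Finset.sum_add_distrib, ← Finset.sum_add_distrib]
    refine Finset.sum_congr rfl fun a _ => ?_
    simp [Layout.SectorState.letters, box]
  have key : ∑ a, (c.transport a).letters = ∑ a, (c a).letters := by
    rw [hsum, hsum]
    congr 1
    simp_rw [hbox]
    exact Equiv.sum_comp hswap.toPerm (box c)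
  unfold Layout.Config.LettersOnce
  rw [key]
  exact hc

end TransportWellDefined

/-- The permutation of the canonical basis that underlies the transport step. -/
noncomputable def Layout.CircuitState.transport {L : Layout.{u}} (c : L.CircuitState) :
    L.CircuitState :=
  ⟨c.1.transport, c.2.transport⟩

/-- The transport step `T`: `T|c⟩ = |transport c⟩`, extended linearly. -/
noncomputable def Layout.transport (L : Layout.{u}) : L.CircuitSpace →ₗ[ℂ] L.CircuitSpace :=
  Matrix.toEuclideanLin
    (Matrix.of fun c' c : L.CircuitState => if c' = c.transport then (1 : ℂ) else 0)

/-- One time step `G = T S`. -/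
noncomputable def Skeleton.step (K : Skeleton.{u}) : K.CircuitSpace →ₗ[ℂ] K.CircuitSpace :=
  K.toLayout.transport ∘ₗ K.scattering

/-- An addressable quantum circuit: a skeleton and a vector of its circuit space (no normalisation is
imposed). -/
structure Circuit : Type (u + 1) where
  skeleton : Skeleton.{u}
  state : skeleton.CircuitSpace

/-- The layout of a circuit. -/
abbrev Circuit.layout (C : Circuit.{u}) : Layout.{u} := C.skeleton.toLayout

/-- The circuit `G C` into which `C` evolves in one time step. -/
noncomputable def Circuit.evolve (C : Circuit.{u}) : Circuit.{u} :=
  { skeleton := C.skeleton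
    state := C.skeleton.step C.state }

/-! ## Labelled graphs with ports -/

/-- A graph with vertices `V`, ports `P`, and labels `Lab v` at `v`. An edge is a pair of distinct half-edges
`v : p`, and every half-edge belongs to at most one edge. -/
@[ext]
structure PortGraph (V P : Type*) (Lab : V → Type*) where
  edges : Set (Sym2 (V × P))
  label : ∀ v, Lab v
  not_isDiag : ∀ E ∈ edges, ¬ E.IsDiag
  eq_of_mem : ∀ E ∈ edges, ∀ E' ∈ edges, ∀ x, x ∈ E → x ∈ E' → E = E'

/-- The vertices `s_a` (sectors) and `r_g` (gates). -/
inductive Layout.Vertex (L : Layout.{u}) : Type where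
  | sector (a : L.Address)
  | gate (g : L.Gate)

/-- The ports `p_a`, `e`, `τ`, `in_i` and `out_i`, where `i` ranges over `|𝒜|` values. -/
inductive Layout.Port (L : Layout.{u}) : Type where
  | member (a : L.Address)
  | entry
  | tau
  | inp (i : Fin L.addresses.card)
  | out (i : Fin L.addresses.card)

/-- A half-edge `v : p`. -/
abbrev Layout.HalfEdge (L : Layout.{u}) : Type := L.Vertex × L.Port

/-- `s_a` carries a pair of data words (input, output), and `r_g` carries a gate operator on `g`. -/
abbrev Layout.Label (L : Layout.{u}) : L.Vertex → Type u
  | .sector _ => L.DataWord × L.DataWord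
  | .gate g => GateOperator L g.1

/-- The labelled port graphs over a layout. -/
abbrev Layout.Graph (L : Layout.{u}) : Type u := PortGraph L.Vertex L.Port L.Label

/-- Finite superpositions `∑ α_k |𝐆_k⟩` of labelled port graphs. -/
abbrev Layout.GraphSpace (L : Layout.{u}) : Type u := L.Graph →₀ ℂ

/-- The edge `{s_a : p, s_z : e}`. -/
def Layout.entryEdge (L : Layout.{u}) (a : L.Address) (p : L.Port) (z : L.Address) :
    Sym2 L.HalfEdge :=
  s((.sector a, p), (.sector z, .entry))

/-- The edge `{s_a : p_a, r_g : p_a}`. -/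
def Layout.memberEdge (L : Layout.{u}) (a : L.Address) (g : L.Gate) : Sym2 L.HalfEdge :=
  s((.sector a, .member a), (.gate g, .member a))

/-! ## The encoding -/

/-- The edges of the graph of a configuration: `{s_a : in_i, a_i : e}` and `{s_a : out_i, a'_i : e}` for the
letters of the stored words, `{s_a : τ, t : e}` for the target, and `{s_a : p_a, r_g : p_a}` for `a ∈ g`. -/
def Layout.Config.edges {L : Layout.{u}} (c : L.Config) : Set (Sym2 L.HalfEdge) :=
  {E | ∃ a i z, (c a).inp.1.1[i.1]? = some z ∧ E = L.entryEdge a (.inp i) z} ∪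
  {E | ∃ a i z, (c a).out.1.1[i.1]? = some z ∧ E = L.entryEdge a (.out i) z} ∪
  {E | ∃ a t, (c a).target = some t ∧ E = L.entryEdge a .tau t} ∪
  {E | ∃ a, ∃ g : L.Gate, a ∈ g.1 ∧ E = L.memberEdge a g}

section GraphWellDefined

variable {L : Layout.{u}}

/-- The address that a port of `s_a` points to when sector `a` is in state `s`. -/
def Layout.SectorState.letterAt (s : L.SectorState) : L.Port → Option L.Address
  | .tau => s.target
  | .inp i => s.inp.1.1[i.1]?
  | .out i => s.out.1.1[i.1]?
  | _ => none

theorem Layout.SectorState.mem_of_letterAt {s : L.SectorState} {p : L.Port} {z : L.Address}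
    (h : s.letterAt p = some z) : z ∈ s.letters := by
  cases p <;> simp only [Layout.SectorState.letterAt, reduceCtorEq] at h
  · exact Layout.SectorState.mem_letters_of_target h
  · simp [Layout.SectorState.letters, List.mem_of_getElem? h]
  · simp [Layout.SectorState.letters, List.mem_of_getElem? h]

theorem Layout.SectorState.letterAt_unique {s : L.SectorState} (hs : s.letters.Nodup)
    {p p' : L.Port} {z : L.Address} (h : s.letterAt p = some z) (h' : s.letterAt p' = some z) :
    p = p' := by
  have getElem_unique : ∀ (w : List L.Address), w.Nodup →
      ∀ i j : ℕ, w[i]? = some z → w[j]? = some z → i = j := by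
    intro w hw i j hi hj
    have hi' := (List.getElem?_eq_some_iff.1 hi).1
    exact (List.getElem?_inj hi' hw).1 (hi.trans hj.symm)
  simp only [Layout.SectorState.letters, Multiset.coe_nodup, List.append_assoc,
    List.nodup_append', List.disjoint_append_right] at hs
  obtain ⟨-, ⟨-, -, hio⟩, hti, hto⟩ := hs
  cases p <;> cases p' <;> simp only [Layout.SectorState.letterAt, reduceCtorEq] at h h' <;>
    try rfl
  · exact (hti (by simp [h]) (List.mem_of_getElem? h')).elim
  · exact (hto (by simp [h]) (List.mem_of_getElem? h')).elim
  · exact (hti (by simp [h']) (List.mem_of_getElem? h)).elim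
  · exact congrArg _ (Fin.ext (getElem_unique _ s.inp.1.2 _ _ h h'))
  · exact (hio (List.mem_of_getElem? h) (List.mem_of_getElem? h')).elim
  · exact (hto (by simp [h']) (List.mem_of_getElem? h)).elim
  · exact (hio (List.mem_of_getElem? h') (List.mem_of_getElem? h)).elim
  · exact congrArg _ (Fin.ext (getElem_unique _ s.out.1.2 _ _ h h'))

theorem Layout.Config.mem_edges {c : L.Config} {E : Sym2 L.HalfEdge} (hE : E ∈ c.edges) :
    (∃ a p z, (c a).letterAt p = some z ∧ E = L.entryEdge a p z) ∨
      ∃ a, ∃ g : L.Gate, a ∈ g.1 ∧ E = L.memberEdge a g := by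
  rcases hE with ((⟨a, i, z, h, rfl⟩ | ⟨a, i, z, h, rfl⟩) | ⟨a, t, h, rfl⟩) | h
  · exact Or.inl ⟨a, .inp i, z, h, rfl⟩
  · exact Or.inl ⟨a, .out i, z, h, rfl⟩
  · exact Or.inl ⟨a, .tau, t, h, rfl⟩
  · exact Or.inr h

theorem Layout.Config.edges_not_isDiag (c : L.Config) : ∀ E ∈ c.edges, ¬ E.IsDiag := by
  intro E hE
  rcases Layout.Config.mem_edges hE with ⟨a, p, z, h, rfl⟩ | ⟨a, g, -, rfl⟩
  · intro hd
    have hd' := congrArg Prod.snd (Sym2.mk_isDiag_iff.1 hd)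
    simp only at hd'
    subst hd'
    simp [Layout.SectorState.letterAt] at h
  · intro hd
    have hd' := congrArg Prod.fst (Sym2.mk_isDiag_iff.1 hd)
    simp at hd'

theorem Layout.Config.LettersOnce.edges_eq_of_mem {c : L.Config} (hc : c.LettersOnce) :
    ∀ E ∈ c.edges, ∀ E' ∈ c.edges, ∀ x, x ∈ E → x ∈ E' → E = E' := by
  have hnodup : ∀ a, (c a).letters.Nodup := fun a =>
    Multiset.nodup_of_le
      (Finset.single_le_sum (f := fun a => (c a).letters) (fun _ _ => Multiset.zero_le _)
        (Finset.mem_univ a)) hc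
  intro E hE E' hE' x hx hx'
  rcases Layout.Config.mem_edges hE with ⟨a, p, z, h, rfl⟩ | ⟨a, g, hg, rfl⟩ <;>
    rcases Layout.Config.mem_edges hE' with ⟨a', p', z', h', rfl⟩ | ⟨a', g', hg', rfl⟩ <;>
    simp only [Layout.entryEdge, Layout.memberEdge, Sym2.mem_iff] at hx hx'
  · rcases hx with rfl | rfl <;> rcases hx' with hx' | hx' <;>
      simp only [Prod.mk.injEq, Layout.Vertex.sector.injEq, and_true] at hx'
    · obtain ⟨rfl, rfl⟩ := hx'
      rw [h] at h'
      rw [Option.some.inj h']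
    · rw [hx'.2] at h
      simp [Layout.SectorState.letterAt] at h
    · rw [← hx'.2] at h'
      simp [Layout.SectorState.letterAt] at h'
    · subst hx'
      obtain rfl := hc.sector_unique (Layout.SectorState.mem_of_letterAt h)
        (Layout.SectorState.mem_of_letterAt h')
      rw [Layout.SectorState.letterAt_unique (hnodup a) h h']
  · rcases hx with rfl | rfl <;> rcases hx' with hx' | hx' <;>
      simp only [Prod.mk.injEq, reduceCtorEq, false_and, and_false] at hx'
    rw [hx'.2] at h
    simp [Layout.SectorState.letterAt] at h
  · rcases hx with rfl | rfl <;> rcases hx' with hx' | hx' <;>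
      simp only [Prod.mk.injEq, reduceCtorEq, false_and, and_false] at hx'
    rw [← hx'.2] at h'
    simp [Layout.SectorState.letterAt] at h'
  · have haa : a = a' := by
      rcases hx with rfl | rfl <;> rcases hx' with hx' | hx' <;> simp_all
    subst haa
    have hgg : g = g' := Subtype.ext (L.gates.disjoint.elim_finset g.2 g'.2 a hg hg')
    rw [hgg]

end GraphWellDefined

/-- The labelled port graph `𝐆_c` of a basis state `c`, the vertices `r_g` being labelled by `op g`. -/
def Layout.CircuitState.graph {L : Layout.{u}} (c : L.CircuitState)
    (op : ∀ g : L.Gate, GateOperator L g.1) : L.Graph where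
  edges := c.1.edges
  label
    | .sector a => ((c.1 a).inp.2, (c.1 a).out.2)
    | .gate g => op g
  not_isDiag := c.1.edges_not_isDiag
  eq_of_mem := c.2.edges_eq_of_mem

/-- The encoding `e(C) = ∑_c ψ_c |𝐆_c⟩` of the circuit `C` with state `ψ = ∑_c ψ_c |c⟩`. -/
noncomputable def Circuit.encode (C : Circuit.{u}) : C.layout.GraphSpace :=
  ∑ c : C.layout.CircuitState, Finsupp.single (c.graph C.skeleton.op) (C.state c)

/-! ## Reading a graph -/

section Reading

variable {L : Layout.{u}}

/-- The operator that labels `r_g`. -/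
def PortGraph.op (Γ : L.Graph) (g : L.Gate) : GateOperator L g.1 := Γ.label (.gate g)

open Classical in
/-- The address `z` such that `{s_a : p, s_z : e}` is an edge, if there is one. -/
noncomputable def PortGraph.letter (Γ : L.Graph) (a : L.Address) (p : L.Port) : Option L.Address :=
  if h : ∃ z, L.entryEdge a p z ∈ Γ.edges then some h.choose else none

open Classical in
/-- The address `a` such that `{s_a : τ, s_t : e}` is an edge, if there is one. -/
noncomputable def PortGraph.source (Γ : L.Graph) (t : L.Address) : Option L.Address :=
  if h : ∃ a, L.entryEdge a .tau t ∈ Γ.edges then some h.choose else none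

theorem PortGraph.letter_eq_some {Γ : L.Graph} {a : L.Address} {p : L.Port} {z : L.Address} :
    Γ.letter a p = some z ↔ L.entryEdge a p z ∈ Γ.edges := by
  unfold PortGraph.letter
  constructor
  · intro h
    split_ifs at h with hex
    · rw [← Option.some.inj h]; exact hex.choose_spec
  · intro h
    have hex : ∃ z, L.entryEdge a p z ∈ Γ.edges := ⟨z, h⟩
    rw [dif_pos hex]
    have heq := Γ.eq_of_mem _ hex.choose_spec _ h (.sector a, p)
      (Sym2.mem_mk_left _ _) (Sym2.mem_mk_left _ _)
    have h2 := Sym2.congr_right.1 heq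
    simp only [Prod.mk.injEq, Layout.Vertex.sector.injEq, and_true] at h2
    exact congrArg some h2

theorem PortGraph.source_eq_some {Γ : L.Graph} {a t : L.Address} :
    Γ.source t = some a ↔ L.entryEdge a .tau t ∈ Γ.edges := by
  unfold PortGraph.source
  constructor
  · intro h
    split_ifs at h with hex
    · rw [← Option.some.inj h]; exact hex.choose_spec
  · intro h
    have hex : ∃ a, L.entryEdge a .tau t ∈ Γ.edges := ⟨a, h⟩
    rw [dif_pos hex]
    have heq := Γ.eq_of_mem _ hex.choose_spec _ h (.sector t, .entry)
      (Sym2.mem_mk_right _ _) (Sym2.mem_mk_right _ _)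
    have h2 := Sym2.congr_left.1 heq
    simp only [Prod.mk.injEq, Layout.Vertex.sector.injEq, and_true] at h2
    exact congrArg some h2

/-- The word read along the ports `port 1, …, port |𝒜|` of `s_a`; ports without an edge contribute `ε`. -/
noncomputable def PortGraph.word (Γ : L.Graph) (port : Fin L.addresses.card → L.Port)
    (a : L.Address) : List L.Address :=
  (List.finRange L.addresses.card).filterMap fun i => Γ.letter a (port i)

theorem PortGraph.word_nodup (Γ : L.Graph) {port : Fin L.addresses.card → L.Port}
    (hport : Function.Injective port) (a : L.Address) :
    (Γ.word port a).Nodup := by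
  refine List.Nodup.filterMap ?_ (List.nodup_finRange _)
  intro i j z hi hj
  have hi' := PortGraph.letter_eq_some.1 (Option.mem_def.1 hi)
  have hj' := PortGraph.letter_eq_some.1 (Option.mem_def.1 hj)
  have heq := Γ.eq_of_mem _ hi' _ hj' (.sector z, .entry)
      (Sym2.mem_mk_right _ _) (Sym2.mem_mk_right _ _)
  have h2 := Sym2.congr_left.1 heq
  simp only [Prod.mk.injEq, true_and] at h2
  exact hport h2

/-- The state `|ψ⟩^a` of sector `a` that is built from the graph. -/
noncomputable def PortGraph.sectorState (Γ : L.Graph) (a : L.Address) : L.SectorState where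
  target := Γ.letter a .tau
  inp := (⟨Γ.word .inp a, Γ.word_nodup (fun _ _ h => by simpa using h) a⟩,
    (Γ.label (.sector a)).1)
  out := (⟨Γ.word .out a, Γ.word_nodup (fun _ _ h => by simpa using h) a⟩,
    (Γ.label (.sector a)).2)

end Reading

/-! ## The graph dynamics -/

section Dynamics

variable {L : Layout.{u}}

/-- The basis graphs on which the dynamics is specified: those of the form `𝐆_c`, with any gate operators as
labels of the gate vertices. -/
def PortGraph.IsCircuitGraph (Γ : L.Graph) : Prop :=
  ∃ (c : L.CircuitState) (op : ∀ g : L.Gate, GateOperator L g.1), Γ = c.graph op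

open Classical in
/-- The scattering step on a basis graph. For all gate vertices `r_g` synchronously, the state of the sectors
of `g` is read from the graph, the operator that labels `r_g` is applied to it, and the edges and labels are
rewritten from the resulting superposition; the labels of the gate vertices stay. Graphs outside the
specified domain are left unchanged. -/
noncomputable def PortGraph.scatter (Γ : L.Graph) : L.GraphSpace :=
  if Γ.IsCircuitGraph then
    ∑ c' : L.CircuitState, Finsupp.single (c'.graph Γ.op)
      (Layout.scatteringAmplitude Γ.op c'.1 Γ.sectorState)
  else Finsupp.single Γ 1

/-- The scattering part `E_S` of the dynamics. -/
noncomputable def Layout.graphScattering (L : Layout.{u}) : L.GraphSpace →ₗ[ℂ] L.GraphSpace :=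
  Finsupp.linearCombination ℂ PortGraph.scatter

/-- For every edge `{s_a : τ, s_t : e}` and every `j`, the half-edges `s_a : out_j` and `s_t : in_j` are
exchanged. -/
noncomputable def PortGraph.exchange (Γ : L.Graph) : L.HalfEdge → L.HalfEdge
  | (.sector a, .out j) => match Γ.letter a .tau with
    | some t => (.sector t, .inp j)
    | none => (.sector a, .out j)
  | (.sector t, .inp j) => match Γ.source t with
    | some a => (.sector a, .out j)
    | none => (.sector t, .inp j)
  | x => x

theorem PortGraph.exchange_involutive (Γ : L.Graph) : Function.Involutive Γ.exchange := by
  rintro ⟨a | g, p⟩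
  · cases p with
    | member | entry | tau => rfl
    | inp j =>
      rcases h : Γ.source a with _ | i
      · simp [PortGraph.exchange, h]
      · have h' : Γ.letter i .tau = some a :=
          PortGraph.letter_eq_some.2 (PortGraph.source_eq_some.1 h)
        simp [PortGraph.exchange, h, h']
    | out j =>
      rcases h : Γ.letter a .tau with _ | t
      · simp [PortGraph.exchange, h]
      · have h' : Γ.source t = some a :=
          PortGraph.source_eq_some.2 (PortGraph.letter_eq_some.1 h)
        simp [PortGraph.exchange, h, h']
  · rfl

/-- The transport step on a basis graph. For every edge `{s_a : τ, s_t : e}` synchronously, the edges at the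
ports `out_j` of `s_a` and `in_j` of `s_t` are exchanged, and so are the second part of the label of `s_a` and
the first part of the label of `s_t`. -/
noncomputable def PortGraph.transport (Γ : L.Graph) : L.Graph where
  edges := Sym2.map Γ.exchange '' Γ.edges
  label
    | .sector a =>
      (match Γ.source a with
        | some i => (Γ.label (.sector i)).2
        | none => (Γ.label (.sector a)).1,
      match Γ.letter a .tau with
        | some t => (Γ.label (.sector t)).1
        | none => (Γ.label (.sector a)).2)
    | .gate g => Γ.label (.gate g)
  not_isDiag := by
    rintro _ ⟨E, hE, rfl⟩
    rw [Sym2.isDiag_map Γ.exchange_involutive.injective]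
    exact Γ.not_isDiag E hE
  eq_of_mem := by
    rintro _ ⟨E, hE, rfl⟩ _ ⟨E', hE', rfl⟩ x hx hx'
    obtain ⟨y, hy, rfl⟩ := Sym2.mem_map.1 hx
    obtain ⟨y', hy', h⟩ := Sym2.mem_map.1 hx'
    obtain rfl := Γ.exchange_involutive.injective h
    rw [Γ.eq_of_mem E hE E' hE' y' hy hy']

/-- The transport part `E_T` of the dynamics. -/
noncomputable def Layout.graphTransport (L : Layout.{u}) : L.GraphSpace →ₗ[ℂ] L.GraphSpace :=
  Finsupp.linearCombination ℂ fun Γ : L.Graph => Finsupp.single Γ.transport 1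

/-- The dynamics `E = E_T E_S`. -/
noncomputable def Layout.graphEvolution (L : Layout.{u}) : L.GraphSpace →ₗ[ℂ] L.GraphSpace :=
  L.graphTransport ∘ₗ L.graphScattering

end Dynamics

end AQC

/-!
The encoding `c ↦ 𝐆_c` intertwines the two dynamics on basis states, and both dynamics are linear.

*Scattering.* A graph `𝐆_c` determines `c`: the edges at the ports of `s_a` are exactly the letters of
sector `a` (`graph_letter`), and since a word without repetitions has at most `|𝒜|` letters, the ports
`in_i` and `out_i` record it completely (`sectorState_graph`). Hence `E_S` applies to `𝐆_c` the same matrix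
elements that `S` applies to `|c⟩`.

*Transport.* The words of all sectors amount to a partial function from half-edges to addresses
(`letterAtHalfEdge`), and the edges of `𝐆_c` other than the membership edges are its graph. Transporting `c`
means composing this function with the involution `exchange`, which is also how `E_T` moves the edges. Hence
`E_T` maps `𝐆_c` to the graph of the transported state (`transport_graph`).
-/

namespace AQC

universe u

variable {L : Layout.{u}}

/-! ### Reading a configuration off its graph -/

/-- The address that a half-edge points to in the configuration `c`; the port `s_z : e`, which is the target
of such a pointer, points nowhere itself. -/
def Layout.Config.letterAtHalfEdge (c : L.Config) : L.HalfEdge → Option L.Address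
  | (.sector a, p) => (c a).letterAt p
  | (.gate _, _) => none

theorem Layout.Config.mem_edges_iff {c : L.Config} {E : Sym2 L.HalfEdge} :
    E ∈ c.edges ↔
      (∃ x z, c.letterAtHalfEdge x = some z ∧ E = s(x, (.sector z, .entry))) ∨
        ∃ a, ∃ g : L.Gate, a ∈ g.1 ∧ E = L.memberEdge a g := by
  constructor
  · intro hE
    rcases Layout.Config.mem_edges hE with ⟨a, p, z, h, rfl⟩ | h
    · exact Or.inl ⟨(.sector a, p), z, h, rfl⟩
    · exact Or.inr h
  · rintro (⟨⟨a | g, p⟩, z, h, rfl⟩ | h)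
    · cases p with
      | member | entry => simp [letterAtHalfEdge, SectorState.letterAt] at h
      | tau => exact Or.inl (Or.inr ⟨a, z, h, rfl⟩)
      | inp i => exact Or.inl (Or.inl (Or.inl ⟨a, i, z, h, rfl⟩))
      | out i => exact Or.inl (Or.inl (Or.inr ⟨a, i, z, h, rfl⟩))
    · simp [letterAtHalfEdge] at h
    · exact Or.inr h

theorem Layout.Config.entryEdge_mem_edges {c : L.Config} {a : L.Address} {p : L.Port}
    {z : L.Address} : L.entryEdge a p z ∈ c.edges ↔ (c a).letterAt p = some z := by
  refine ⟨fun hE => ?_, fun h => mem_edges_iff.2 (Or.inl ⟨(.sector a, p), z, h, rfl⟩)⟩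
  rcases Layout.Config.mem_edges hE with ⟨a', p', z', h, heq⟩ | ⟨a', g, -, heq⟩
  · simp only [Layout.entryEdge, Sym2.eq_iff, Prod.mk.injEq, Layout.Vertex.sector.injEq,
      and_true] at heq
    rcases heq with ⟨⟨rfl, rfl⟩, rfl⟩ | ⟨-, -, rfl⟩
    · exact h
    -- an edge whose two ends are exchanged would have `e` as its pointing port
    · simp [SectorState.letterAt] at h
  · simp [Layout.entryEdge, Layout.memberEdge] at heq

theorem Layout.CircuitState.graph_letter (c : L.CircuitState)
    (op : ∀ g : L.Gate, GateOperator L g.1) (a : L.Address) (p : L.Port) :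
    PortGraph.letter (c.graph op) a p = (c.1 a).letterAt p :=
  Option.ext fun _ => PortGraph.letter_eq_some.trans Layout.Config.entryEdge_mem_edges

theorem Layout.CircuitState.graph_source (c : L.CircuitState)
    (op : ∀ g : L.Gate, GateOperator L g.1) (t : L.Address) :
    PortGraph.source (c.graph op) t = c.1.source t :=
  Option.ext fun _ => PortGraph.source_eq_some.trans
    (Layout.Config.entryEdge_mem_edges.trans c.2.source_eq_some.symm)

theorem filterMap_finRange_getElem? {α : Type*} (w : List α) {n : ℕ} (h : w.length ≤ n) :
    ((List.finRange n).filterMap fun i => w[i.1]?) = w := by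
  induction w generalizing n with
  | nil => simp
  | cons x w ih =>
    obtain ⟨m, rfl⟩ : ∃ m, n = m + 1 := ⟨n - 1, by simp at h; omega⟩
    rw [List.finRange_succ, List.filterMap_cons]
    simp only [Fin.val_zero, List.getElem?_cons_zero, List.filterMap_map]
    congr 1
    exact ih (by simpa using h)

/-- The `|𝒜|` ports `in_i` (or `out_i`) have room for every word of distinct addresses. -/
theorem Layout.StoredWord.length_le (w : L.StoredWord) : w.1.length ≤ L.addresses.card := by
  simpa using w.2.length_le_card

/-- Reading the graph `𝐆_c` returns the configuration `c`. -/
theorem Layout.CircuitState.sectorState_graph (c : L.CircuitState)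
    (op : ∀ g : L.Gate, GateOperator L g.1) :
    PortGraph.sectorState (c.graph op) = c.1 := by
  funext a
  refine Layout.SectorState.ext (c.graph_letter op a .tau) (Prod.ext (Subtype.ext ?_) rfl)
    (Prod.ext (Subtype.ext ?_) rfl)
  · simp only [PortGraph.sectorState, PortGraph.word, graph_letter]
    exact filterMap_finRange_getElem? _ (c.1 a).inp.1.length_le
  · simp only [PortGraph.sectorState, PortGraph.word, graph_letter]
    exact filterMap_finRange_getElem? _ (c.1 a).out.1.length_le

/-! ### Transport of graphs -/

theorem Layout.CircuitState.letterAtHalfEdge_transport (c : L.CircuitState)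
    (op : ∀ g : L.Gate, GateOperator L g.1) (x : L.HalfEdge) :
    c.1.transport.letterAtHalfEdge x =
      c.1.letterAtHalfEdge (PortGraph.exchange (c.graph op) x) := by
  rcases x with ⟨a | g, p⟩
  · cases p with
    | member | entry | tau => rfl
    | inp j =>
      rcases h : c.1.source a with _ | i <;>
        simp [Config.letterAtHalfEdge, PortGraph.exchange, graph_source, Config.transport,
          SectorState.letterAt, h]
    | out j =>
      rcases h : (c.1 a).target with _ | t <;>
        simp [Config.letterAtHalfEdge, PortGraph.exchange, graph_letter, Config.transport,
          SectorState.letterAt, h]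
  · rfl

theorem Layout.CircuitState.edges_transport (c : L.CircuitState)
    (op : ∀ g : L.Gate, GateOperator L g.1) :
    Sym2.map (PortGraph.exchange (c.graph op)) '' c.1.edges = c.1.transport.edges := by
  have hinv := PortGraph.exchange_involutive (c.graph op)
  ext E
  constructor
  · rintro ⟨E, hE, rfl⟩
    rcases Config.mem_edges_iff.1 hE with ⟨x, z, h, rfl⟩ | ⟨a, g, hg, rfl⟩
    · refine Config.mem_edges_iff.2 (Or.inl ⟨_, z, ?_, rfl⟩)
      rw [c.letterAtHalfEdge_transport op, hinv x, h]
    · exact Config.mem_edges_iff.2 (Or.inr ⟨a, g, hg, rfl⟩)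
  · intro hE
    rcases Config.mem_edges_iff.1 hE with ⟨x, z, h, rfl⟩ | ⟨a, g, hg, rfl⟩
    · rw [c.letterAtHalfEdge_transport op] at h
      refine ⟨_, Config.mem_edges_iff.2 (Or.inl ⟨_, z, h, rfl⟩), ?_⟩
      rw [Sym2.map_mk, hinv x]
      rfl
    · exact ⟨_, Config.mem_edges_iff.2 (Or.inr ⟨a, g, hg, rfl⟩), rfl⟩

/-- The transport of graphs realises the transport of circuit states. -/
theorem Layout.CircuitState.transport_graph (c : L.CircuitState)
    (op : ∀ g : L.Gate, GateOperator L g.1) :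
    PortGraph.transport (c.graph op) = c.transport.graph op := by
  refine PortGraph.ext (c.edges_transport op) (funext fun v => ?_)
  rcases v with a | g
  · refine Prod.ext ?_ ?_
    · simp only [PortGraph.transport, graph_source]
      rcases h : c.1.source a with _ | i <;>
        simp [graph, CircuitState.transport, Config.transport, h]
    · simp only [PortGraph.transport, graph_letter, SectorState.letterAt]
      rcases h : (c.1 a).target with _ | t <;>
        simp [graph, CircuitState.transport, Config.transport, h]
  · rfl

/-! ### Linear extension -/

theorem Layout.CircuitState.graphTransport_single (c : L.CircuitState)
    (op : ∀ g : L.Gate, GateOperator L g.1) (α : ℂ) :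
    L.graphTransport (Finsupp.single (c.graph op) α) =
      Finsupp.single (c.transport.graph op) α := by
  simp [Layout.graphTransport, transport_graph]

theorem Layout.CircuitState.graphScattering_single (c : L.CircuitState)
    (op : ∀ g : L.Gate, GateOperator L g.1) (α : ℂ) :
    L.graphScattering (Finsupp.single (c.graph op) α) =
      ∑ c' : L.CircuitState,
        Finsupp.single (c'.graph op) (Layout.scatteringAmplitude op c'.1 c.1 * α) := by
  have hop : PortGraph.op (c.graph op) = op := rfl
  have hc : PortGraph.IsCircuitGraph (c.graph op) := ⟨c, op, rfl⟩
  simp [Layout.graphScattering, PortGraph.scatter, hc, hop, sectorState_graph, Finset.smul_sum,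
    mul_comm]

theorem Skeleton.scattering_apply (K : Skeleton.{u}) (ψ : K.CircuitSpace) (c' : K.CircuitState) :
    K.scattering ψ c' =
      ∑ c : K.CircuitState, Layout.scatteringAmplitude K.op c'.1 c.1 * ψ c := by
  simp [Skeleton.scattering, Matrix.toLpLin_apply, Matrix.mulVec, dotProduct]

theorem Layout.transport_apply (ψ : L.CircuitSpace) (d : L.CircuitState) :
    L.transport ψ d = ∑ c : L.CircuitState, if d = c.transport then ψ c else 0 := by
  simp [Layout.transport, Matrix.toLpLin_apply, Matrix.mulVec, dotProduct]

/-- Encoding a transported superposition is a pushforward: the graph of `c.transport` receives the amplitude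
of `c`. -/
theorem Layout.sum_single_transport (ψ : L.CircuitSpace)
    (op : ∀ g : L.Gate, GateOperator L g.1) :
    ∑ d : L.CircuitState, Finsupp.single (d.graph op) (L.transport ψ d) =
      ∑ c : L.CircuitState, Finsupp.single (c.transport.graph op) (ψ c) := by
  simp_rw [Layout.transport_apply, Finsupp.single_finsetSum]
  rw [Finset.sum_comm]
  refine Finset.sum_congr rfl fun c _ => ?_
  rw [Finset.sum_eq_single c.transport]
  · simp
  · intro d _ hd
    simp [hd]
  · simp

end AQC

theorem mainTheorem8 (C : AQC.Circuit) :
    C.evolve.encode = C.layout.graphEvolution C.encode := by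
  obtain ⟨K, ψ⟩ := C
  have hL : AQC.Circuit.encode (AQC.Circuit.evolve ⟨K, ψ⟩) =
      ∑ c : K.CircuitState, Finsupp.single (c.transport.graph K.op) (K.scattering ψ c) :=
    AQC.Layout.sum_single_transport (K.scattering ψ) K.op
  rw [hL]
  simp only [AQC.Circuit.encode, AQC.Layout.graphEvolution, LinearMap.comp_apply, map_sum,
    AQC.Layout.CircuitState.graphScattering_single,
    AQC.Layout.CircuitState.graphTransport_single, AQC.Skeleton.scattering_apply,
    Finsupp.single_finsetSum]
  exact Finset.sum_comm
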